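/- Let $f,h:[0,1]\to\mathbb R$ be twice continuously differentiable with $f(1)<0<f(0)$, $h(1)=0$, $h'(1)\neq 0$ and $h(x)>0$ for $x\in[0,1)$, and fix $\beta\in(0,1/2)$. For $\varepsilon>0$ let $x^\varepsilon=(x^\varepsilon_t)_{t\ge 0}$ be the $[0,1]$-valued solution of $$\varepsilon\,\dot x^\varepsilon_t=\varepsilon f(x^\varepsilon_t)+x^\varepsilon_t\,h(x^\varepsilon_t),\qquad x^\varepsilon_0=0.$$ Let $(\sigma^\varepsilon_n)_{n\ge1}$ be i.i.d. positive random variables with $$\mathbb P(\sigma^\varepsilon_n>t)=\exp\Big(-\varepsilon^{-1}\int_0^t h(x^\varepsilon_s)\,ds\Big)\qquad (t>0),$$ put $\tau^\varepsilon_0=0$, $\tau^\varepsilon_n=\sigma^\varepsilon_1+\dots+\sigma^\varepsilon_n$, and let $X^\varepsilon$ be the process with $X^\varepsilon_t=x^\varepsilon_{t-\tau^\varepsilon_n}$ for $t\in[\tau^\varepsilon_n,\tau^\varepsilon_{n+1})$, $n\ge0$. (The underlying probability space may depend on $\varepsilon$.) Put $y^\varepsilon_*=1-\varepsilon^\beta$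 and $$e^\varepsilon_1=\inf\{t\ge0\,;\,X^\varepsilon_t>y^\varepsilon_*\}\in[0,\infty].$$ Then $e_1^\varepsilon<\infty$ almost surely for all sufficiently small $\varepsilon>0$, and $e^\varepsilon_1$ converges in distribution, as $\varepsilon\to0^+$, to an exponential random variable with parameter (rate) $f(0)$. -/

import Mathlib

open MeasureTheory ProbabilityTheory Filter Topology

namespace SpikeReset

/-- The drift `ω^ε(x) = ε f(x) + x h(x)`. -/
def drift (f h : ℝ → ℝ) (ε x : ℝ) : ℝ := ε * f x + x * h x

/-- `x` is the deterministic flow on the state space `[0,1]` started at `0`: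
`ε x'(t) = ω^ε(x(t))` for every `t ≥ 0` (one-sided derivative at `t = 0`) and `x(0) = 0`.
Only the values `x t` with `t ≥ 0` matter. -/
structure IsFlow (f h : ℝ → ℝ) (ε : ℝ) (x : ℝ → ℝ) : Prop where
  init : x 0 = 0
  mem_Icc : ∀ t, 0 ≤ t → x t ∈ Set.Icc (0 : ℝ) 1
  ode : ∀ t, 0 ≤ t → HasDerivWithinAt x (ε⁻¹ * drift f h ε (x t)) (Set.Ici 0) t

/-- The survival function `μ_t^ε = exp (-ε⁻¹ ∫₀ᵗ h(x_s) ds)`. -/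
noncomputable def survival (h : ℝ → ℝ) (ε : ℝ) (x : ℝ → ℝ) (t : ℝ) : ℝ :=
  Real.exp (-(ε⁻¹ * ∫ s in (0 : ℝ)..t, h (x s)))

/-- `σ 0, σ 1, …` are the i.i.d. positive waiting times between resettings (`σ n` is the
`(n+1)`-st one), with `P(σ n > t) = μ_t^ε` for `t > 0`. -/
structure IsWaitingTimes {Ω : Type*} [MeasurableSpace Ω] (P : Measure Ω)
    (h : ℝ → ℝ) (ε : ℝ) (x : ℝ → ℝ) (σ : ℕ → Ω → ℝ) : Prop where
  measurable : ∀ n, Measurable (σ n)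
  pos : ∀ n, ∀ᵐ ω ∂P, 0 < σ n ω
  indep : iIndepFun σ P
  tail : ∀ n, ∀ t, 0 < t → P {ω | t < σ n ω} = ENNReal.ofReal (survival h ε x t)

/-- The resetting times `τ_0 = 0`, `τ_n = σ_1 + ⋯ + σ_n`. -/
def resetTime {Ω : Type*} (σ : ℕ → Ω → ℝ) (n : ℕ) (ω : Ω) : ℝ :=
  ∑ i ∈ Finset.range n, σ i ω

open Classical in
/-- The resetting process: `X_t = x_{t - τ_n}` for `t ∈ [τ_n, τ_{n+1})`. Almost surely every
`t ≥ 0` lies in exactly one of these intervals; the value `0` is used if there is none. -/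
noncomputable def resetProcess {Ω : Type*} (x : ℝ → ℝ) (σ : ℕ → Ω → ℝ) (t : ℝ) (ω : Ω) : ℝ :=
  if hn : ∃ n, resetTime σ n ω ≤ t ∧ t < resetTime σ (n + 1) ω then
    x (t - resetTime σ hn.choose ω)
  else 0

/-- The threshold `y_*^ε = 1 - ε^β`. -/
noncomputable def threshold (β ε : ℝ) : ℝ := 1 - ε ^ β

/-- The first passage time `inf {t ≥ 0 ; X_t > y}`, with values in `[0, ∞]`; it is `∞` if the
level `y` is never exceeded. -/
noncomputable def passageTime {Ω : Type*} (X : ℝ → Ω → ℝ) (y : ℝ) (ω : Ω) : ENNReal :=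
  sInf (ENNReal.ofReal '' {t : ℝ | 0 ≤ t ∧ y < X t ω})

/-- The time `e_1^ε` of the first jump from `0` to `1`. -/
noncomputable def firstJump {Ω : Type*} (β ε : ℝ) (x : ℝ → ℝ) (σ : ℕ → Ω → ℝ) (ω : Ω) : ENNReal :=
  passageTime (resetProcess x σ) (threshold β ε) ω

end SpikeReset

/-! Let `T` be the time the flow needs to pass the threshold `y`. The process can only pass `y` in a
cycle longer than `T`, so the passage time is `τ_N + T`, where `N` is the index of the first waiting
time exceeding `T`. This is a geometric sum. With `p = P(σ > T) = μ_T` and `φ = E[exp(iθσ); σ ≤ T]`,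
its characteristic function is `exp(iθT) p / (1 - φ)` (`charFun_of_eq_on_firstExceedance`).

The passage time `T` tends to `0`: the speed of the flow is at least `f 0 / 2` near `0`, and of
order at least `ε^(β-1)` from there up to the threshold (`eventually_exists_isGLB`). Hence `1 - φ =
p - iθm + O(θ² T m)`, with `m = E[σ; σ ≤ T] = A - Tp` and `A = ∫₀ᵀ μ`, and only the limit of `A / p`
is missing.

It comes from the identity `(xμ)' = μ f(x)`, in which `h` cancels. Integration gives `y p = ∫₀ᵀ μ
f(x)`, and the right side is `f 0 * A` up to a relative error `O(T)`
(`IsFlow.abs_mul_survival_sub_le`). As `y → 1`, the ratio `A / p` tends to `1 / f 0`, and the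
characteristic functions tend to `f 0 / (f 0 - iθ)`, that of the exponential law
(`tendsto_geometric_charFun`). -/

namespace SpikeReset

/-! ### Pathwise description of the passage time -/

section Path

variable {Ω : Type*} {x : ℝ → ℝ} {σ : ℕ → Ω → ℝ} {y T : ℝ} {ω : Ω}

lemma resetTime_succ (σ : ℕ → Ω → ℝ) (n : ℕ) (ω : Ω) :
    resetTime σ (n + 1) ω = resetTime σ n ω + σ n ω := by
  simp [resetTime, Finset.sum_range_succ]

lemma resetTime_mono (hpos : ∀ n, 0 < σ n ω) : Monotone (fun n => resetTime σ n ω) :=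
  monotone_nat_of_le_succ fun n => by
    have := hpos n
    rw [resetTime_succ]; linarith

lemma resetTime_nonneg (hpos : ∀ n, 0 < σ n ω) (n : ℕ) : 0 ≤ resetTime σ n ω :=
  Finset.sum_nonneg fun i _ => (hpos i).le

/-- The intervals between consecutive resetting times are disjoint, so the index picked by choice is
the given one. -/
lemma resetProcess_eq (hpos : ∀ n, 0 < σ n ω) {t : ℝ} {m : ℕ} (h1 : resetTime σ m ω ≤ t)
    (h2 : t < resetTime σ (m + 1) ω) : resetProcess x σ t ω = x (t - resetTime σ m ω) := by
  have hex : ∃ n, resetTime σ n ω ≤ t ∧ t < resetTime σ (n + 1) ω := ⟨m, h1, h2⟩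
  have hc := hex.choose_spec
  have hm : hex.choose = m := by
    rcases lt_trichotomy hex.choose m with h | h | h
    · have := resetTime_mono hpos (Nat.succ_le_of_lt h)
      exact absurd (hc.2.trans_le (this.trans h1)) (lt_irrefl _)
    · exact h
    · have := resetTime_mono hpos (Nat.succ_le_of_lt h)
      exact absurd (h2.trans_le (this.trans hc.1)) (lt_irrefl _)
  rw [resetProcess, dif_pos hex, hm]

lemma exists_resetTime_interval {t : ℝ} (ht : 0 ≤ t) {n : ℕ} (hn : t < resetTime σ n ω) :
    ∃ m < n, resetTime σ m ω ≤ t ∧ t < resetTime σ (m + 1) ω := by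
  induction n with
  | zero => simp [resetTime] at hn; linarith
  | succ n ih =>
    by_cases h : t < resetTime σ n ω
    · obtain ⟨m, hm, h'⟩ := ih h
      exact ⟨m, by omega, h'⟩
    · exact ⟨n, by omega, not_lt.1 h, hn⟩

/-- If `n` is the index of the first waiting time exceeding the time `T` which the flow needs to
pass the level `y`, then the resetting process passes the level `y` at time `τ_n + T`. -/
lemma passageTime_resetProcess_eq (hT : IsGLB {t : ℝ | 0 ≤ t ∧ y < x t} T)
    (hpos : ∀ n, 0 < σ n ω) {n : ℕ} (hle : ∀ i < n, σ i ω ≤ T) (hn : T < σ n ω) :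
    passageTime (resetProcess x σ) y ω = ENNReal.ofReal (resetTime σ n ω + T) := by
  have hbelow : ∀ s, 0 ≤ s → s < T → x s ≤ y := fun s h0 h1 => by
    by_contra hc
    exact absurd (hT.1 ⟨h0, not_le.1 hc⟩) (not_le.2 h1)
  have hT0 : 0 ≤ T := hT.2 fun t ht => ht.1
  have hτ0 := resetTime_nonneg hpos n
  apply le_antisymm
  -- The infimum need not be attained, so a passage is found just after age `T`: before the next
  -- reset and before an arbitrary later time `r`.
  · refine le_of_forall_gt_imp_ge_of_dense fun c hc => ?_
    obtain ⟨r, hr1, hr2⟩ := exists_between hc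
    have hrtop : r ≠ ⊤ := (hr2.trans_le le_top).ne
    have hr : resetTime σ n ω + T < r.toReal := by
      rw [ENNReal.ofReal_lt_iff_lt_toReal (by positivity) hrtop] at hr1
      exact hr1
    obtain ⟨s, ⟨hs0, hsy⟩, hs⟩ := (isGLB_lt_iff hT).1
      (show T < min (σ n ω) (r.toReal - resetTime σ n ω) from lt_min hn (by linarith))
    have hsσ := hs.trans_le (min_le_left _ _)
    have hsr := hs.trans_le (min_le_right _ _)
    refine le_trans (sInf_le ⟨resetTime σ n ω + s, ⟨by positivity, ?_⟩, rfl⟩) ?_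
    · rw [resetProcess_eq hpos (m := n) (by linarith) (by rw [resetTime_succ]; linarith)]
      simpa using hsy
    · refine le_trans ?_ hr2.le
      rw [ENNReal.ofReal_le_iff_le_toReal hrtop]
      linarith
  · refine le_sInf ?_
    rintro _ ⟨t, ⟨ht0, hty⟩, rfl⟩
    refine ENNReal.ofReal_le_ofReal ?_
    by_contra! hlt
    obtain ⟨m, hm, h1, h2⟩ := exists_resetTime_interval (n := n + 1) ht0
      (by rw [resetTime_succ]; linarith)
    rw [resetProcess_eq hpos h1 h2] at hty
    refine absurd (hbelow _ (by linarith) ?_) (not_le.2 hty)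
    rw [resetTime_succ] at h2
    -- In both cases the age `t - τ_m` is below `T`: for `m < n` because the whole cycle lasts at
    -- most `T`, for `m = n` because `t < τ_n + T`.
    rcases Nat.lt_succ_iff_lt_or_eq.1 hm with h | rfl
    · linarith [hle m h]
    · linarith

lemma passageTime_resetProcess_eq_top (hx : x 0 = 0) (hxy : ∀ t, 0 ≤ t → x t ≤ y) :
    passageTime (resetProcess x σ) y ω = ⊤ := by
  have : {t : ℝ | 0 ≤ t ∧ y < resetProcess x σ t ω} = ∅ := by
    refine Set.eq_empty_iff_forall_notMem.2 fun t ht => absurd ht.2 (not_lt.2 ?_)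
    unfold resetProcess
    split_ifs with h
    · exact hxy _ (by linarith [h.choose_spec.1])
    · exact hx ▸ hxy 0 le_rfl
  simp [passageTime, this]

/-- The event that `σ n` is the first of the waiting times to exceed `T`. -/
def firstExceedance (σ : ℕ → Ω → ℝ) (T : ℝ) (n : ℕ) : Set Ω :=
  {ω | (∀ i < n, σ i ω ≤ T) ∧ T < σ n ω}

lemma pairwise_disjoint_firstExceedance (σ : ℕ → Ω → ℝ) (T : ℝ) :
    Pairwise (Function.onFun Disjoint (firstExceedance σ T)) := by
  intro m n hmn
  refine Set.disjoint_left.2 fun ω h1 h2 => ?_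
  rcases lt_or_gt_of_ne hmn with h | h
  · exact absurd (h2.1 m h) (not_le.2 h1.2)
  · exact absurd (h1.1 n h) (not_le.2 h2.2)

lemma exists_mem_firstExceedance {ω : Ω} (h : ∃ n, T < σ n ω) :
    ∃ n, ω ∈ firstExceedance σ T n := by
  classical
  exact ⟨Nat.find h, fun i hi => not_lt.1 (Nat.find_min h hi), Nat.find_spec h⟩

end Path

/-! ### Characteristic function of a geometric sum -/

section Geometric

variable {Ω : Type*} [MeasurableSpace Ω] {P : Measure Ω}
  {σ : ℕ → Ω → ℝ} {T : ℝ}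

/-- The characteristic function of `σ 0` truncated to the event `σ 0 ≤ T`. -/
noncomputable def truncatedCharFun (P : Measure Ω) (s : Ω → ℝ) (T θ : ℝ) : ℂ :=
  ∫ ω, (if s ω ≤ T then Complex.exp (θ * s ω * Complex.I) else 0) ∂P

lemma measurableSet_firstExceedance (hm : ∀ n, Measurable (σ n)) (n : ℕ) :
    MeasurableSet (firstExceedance σ T n) := by
  unfold firstExceedance
  have h1 : MeasurableSet {ω | ∀ i < n, σ i ω ≤ T} := by
    have : {ω | ∀ i < n, σ i ω ≤ T} = ⋂ i, ⋂ (_ : i < n), {ω | σ i ω ≤ T} := by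
      ext; simp
    rw [this]
    exact MeasurableSet.iInter fun i => MeasurableSet.iInter fun _ =>
      measurableSet_le (hm i) measurable_const
  exact h1.inter (measurableSet_lt measurable_const (hm n))

/-- Independent copies of a random variable exceeding `T` with positive probability exceed `T`
eventually. -/
lemma ae_exists_lt [IsProbabilityMeasure P] (hm : ∀ n, Measurable (σ n)) (hi : iIndepFun σ P)
    (hid : ∀ n, P.map (σ n) = P.map (σ 0)) (hp : 0 < P {ω | T < σ 0 ω}) :
    ∀ᵐ ω ∂P, ∃ n, T < σ n ω := by
  have hq : P (σ 0 ⁻¹' Set.Iic T) < 1 := by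
    have : σ 0 ⁻¹' Set.Iic T = {ω | T < σ 0 ω}ᶜ := by ext; simp
    rw [this, prob_compl_eq_one_sub (measurableSet_lt measurable_const (hm 0))]
    exact ENNReal.sub_lt_self (by simp) (by simp) hp.ne'
  rw [ae_iff]
  have hb : ∀ m : ℕ, P {ω | ¬ ∃ n, T < σ n ω} ≤ P (σ 0 ⁻¹' Set.Iic T) ^ m := fun m => by
    have h := hi.measure_inter_preimage_eq_mul (Finset.range m) (sets := fun _ => Set.Iic T)
      fun _ _ => measurableSet_Iic
    have h' : ∀ i, P (σ i ⁻¹' Set.Iic T) = P (σ 0 ⁻¹' Set.Iic T) := fun i => by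
      rw [← Measure.map_apply (hm i) measurableSet_Iic, hid i,
        Measure.map_apply (hm 0) measurableSet_Iic]
    simp only [h', Finset.prod_const, Finset.card_range] at h
    rw [← h]
    refine measure_mono fun ω hω => ?_
    simp only [not_exists, not_lt, Set.mem_ofPred_eq] at hω
    simp [hω]
  exact le_antisymm (ge_of_tendsto' (ENNReal.tendsto_pow_atTop_nhds_zero_of_lt_one hq) hb)
    bot_le

lemma setIntegral_firstExceedance (hm : ∀ n, Measurable (σ n)) (hi : iIndepFun σ P)
    (hid : ∀ n, P.map (σ n) = P.map (σ 0)) (θ : ℝ) (n : ℕ) :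
    ∫ ω in firstExceedance σ T n, Complex.exp (θ * ((resetTime σ n ω + T : ℝ) : ℂ) * Complex.I) ∂P
      = truncatedCharFun P (σ 0) T θ ^ n *
        (Complex.exp (θ * T * Complex.I) * P.real {ω | T < σ 0 ω}) := by
  set g : ℝ → ℂ := fun s => if s ≤ T then Complex.exp (θ * s * Complex.I) else 0 with hg
  set k : ℝ → ℂ := fun s => if T < s then Complex.exp (θ * T * Complex.I) else 0 with hk
  have hgm : Measurable g := Measurable.ite measurableSet_Iic (by fun_prop) measurable_const
  have hkm : Measurable k := Measurable.ite measurableSet_Ioi measurable_const measurable_const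
  -- The product of the `G i (σ i)` vanishes off the event and equals the integrand on it: each of
  -- the first `n` factors carries the indicator of `σ i ≤ T`, the last that of `T < σ n`.
  -- Independence then factorises the integral.
  set G : Fin (n + 1) → ℝ → ℂ := fun i => if i = Fin.last n then k else g with hG
  have hGm : ∀ i, Measurable (G i) := fun i => by
    simp only [hG]; split_ifs <;> assumption
  have key := (hi.precomp (g := fun i : Fin (n + 1) => (i : ℕ)) Fin.val_injective).integral_fun_prod_comp
    (fun i => (hm i).aemeasurable) (f := G) (fun i => (hGm i).aestronglyMeasurable)
  have hcopy : ∀ (u : ℝ → ℂ), Measurable u → ∀ i, ∫ ω, u (σ i ω) ∂P = ∫ ω, u (σ 0 ω) ∂P :=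
    fun u hu i => by
      rw [← integral_map (hm i).aemeasurable hu.aestronglyMeasurable, hid i,
        integral_map (hm 0).aemeasurable hu.aestronglyMeasurable]
  have hkint : ∫ ω, k (σ 0 ω) ∂P = Complex.exp (θ * T * Complex.I) * P.real {ω | T < σ 0 ω} := by
    have : (fun ω => k (σ 0 ω)) =
        {ω | T < σ 0 ω}.indicator (fun _ => Complex.exp (θ * T * Complex.I)) := by
      ext ω; simp [hk, Set.indicator_apply]
    rw [this, integral_indicator_const _ (measurableSet_lt measurable_const (hm 0))]
    simp [mul_comm]
  rw [Fin.prod_univ_castSucc] at key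
  simp only [hG, Fin.castSucc_ne_last, if_false, if_true] at key
  have hR : ∏ i : Fin n, ∫ ω, g (σ i.castSucc ω) ∂P = truncatedCharFun P (σ 0) T θ ^ n := by
    rw [Finset.prod_congr rfl fun i _ => hcopy g hgm _]
    simp [truncatedCharFun, hg]
  rw [hR, hcopy k hkm, hkint] at key
  rw [← key, ← integral_indicator (measurableSet_firstExceedance hm n)]
  congr 1
  ext ω
  rw [Fin.prod_univ_castSucc]
  simp only [Fin.castSucc_ne_last, if_false, if_true, Fin.val_castSucc, Fin.val_last]
  rw [Fin.prod_univ_eq_prod_range (fun i => g (σ i ω)) n]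
  by_cases h : ω ∈ firstExceedance σ T n
  · rw [Set.indicator_of_mem h]
    have h1 : ∀ i ∈ Finset.range n, g (σ i ω) = Complex.exp (θ * σ i ω * Complex.I) := fun i hi => by
      simp [hg, h.1 i (Finset.mem_range.1 hi)]
    rw [Finset.prod_congr rfl h1, ← Complex.exp_sum]
    simp only [hk, if_pos h.2]
    rw [← Complex.exp_add]
    congr 1
    simp only [resetTime]
    push_cast
    rw [← Finset.sum_mul, ← Finset.mul_sum]
    ring
  · rw [Set.indicator_of_notMem h]
    simp only [firstExceedance, Set.mem_ofPred_eq, not_and_or, not_forall, not_le, not_lt] at h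
    rcases h with ⟨i, hi, h⟩ | h
    · rw [Finset.prod_eq_zero (Finset.mem_range.2 hi) (by simp [hg, h]), zero_mul]
    · simp [hk, not_lt.2 h]

variable [IsProbabilityMeasure P]

/-- The bound is below `1` once `T` is exceeded with positive probability, which makes the geometric
series over the number of failed cycles converge. -/
lemma norm_truncatedCharFun_le (hm : Measurable (σ 0)) (θ : ℝ) :
    ‖truncatedCharFun P (σ 0) T θ‖ ≤ 1 - P.real {ω | T < σ 0 ω} := by
  have hms := measurableSet_lt measurable_const hm (f := fun _ => T)
  calc ‖truncatedCharFun P (σ 0) T θ‖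
      ≤ ∫ ω, ({ω | T < σ 0 ω}ᶜ).indicator (fun _ => (1 : ℝ)) ω ∂P := by
        refine norm_integral_le_of_norm_le ((integrable_const _).indicator hms.compl)
          (ae_of_all _ fun ω => ?_)
        by_cases h : σ 0 ω ≤ T
        · rw [if_pos h, Set.indicator_of_mem (by simpa using h)]
          have := Complex.norm_exp_ofReal_mul_I (θ * σ 0 ω)
          push_cast at this
          exact this.le
        · rw [if_neg h, norm_zero]
          exact Set.indicator_nonneg (fun _ _ => zero_le_one) _
    _ = 1 - P.real {ω | T < σ 0 ω} := by
        rw [integral_indicator_const _ hms.compl, probReal_compl_eq_one_sub hms]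
        simp

/-- The characteristic function of the geometric sum `τ_N + T`, where `N` is the index of the first
waiting time exceeding `T`. -/
lemma charFun_of_eq_on_firstExceedance (hm : ∀ n, Measurable (σ n)) (hi : iIndepFun σ P)
    (hid : ∀ n, P.map (σ n) = P.map (σ 0)) (hp : 0 < P {ω | T < σ 0 ω})
    {E : Ω → ℝ} (hE : AEMeasurable E P)
    (hEeq : ∀ᵐ ω ∂P, ∀ n, ω ∈ firstExceedance σ T n → E ω = resetTime σ n ω + T) (θ : ℝ) :
    charFun (P.map E) θ = Complex.exp (θ * T * Complex.I) *
      (P.real {ω | T < σ 0 ω} / (1 - truncatedCharFun P (σ 0) T θ)) := by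
  have hpr : 0 < P.real {ω | T < σ 0 ω} := ENNReal.toReal_pos hp.ne' (measure_ne_top _ _)
  have hun : (⋃ n, firstExceedance σ T n) =ᵐ[P] (Set.univ : Set Ω) := by
    rw [eventuallyEq_univ]
    filter_upwards [ae_exists_lt hm hi hid hp] with ω hω
    exact Set.mem_iUnion.2 (exists_mem_firstExceedance hω)
  have hcont : Continuous fun s : ℝ => Complex.exp (θ * s * Complex.I) := by fun_prop
  have hint : Integrable (fun ω => Complex.exp (θ * E ω * Complex.I)) P := by
    refine Integrable.of_bound (hcont.measurable.comp_aemeasurable hE).aestronglyMeasurable 1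
      (ae_of_all _ fun ω => ?_)
    have := Complex.norm_exp_ofReal_mul_I (θ * E ω)
    push_cast at this
    exact this.le
  have hsum := hasSum_integral_iUnion (measurableSet_firstExceedance (T := T) hm)
    (pairwise_disjoint_firstExceedance σ T) hint.integrableOn
  rw [setIntegral_congr_set hun, setIntegral_univ] at hsum
  have hterm : ∀ n, ∫ ω in firstExceedance σ T n, Complex.exp (θ * E ω * Complex.I) ∂P =
      truncatedCharFun P (σ 0) T θ ^ n *
        (Complex.exp (θ * T * Complex.I) * P.real {ω | T < σ 0 ω}) := fun n => by
    rw [← setIntegral_firstExceedance hm hi hid θ n]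
    refine setIntegral_congr_ae (measurableSet_firstExceedance hm n) ?_
    filter_upwards [hEeq] with ω hω h
    rw [hω n h]
  simp only [hterm] at hsum
  have hgeo := (hasSum_geometric_of_norm_lt_one (ξ := truncatedCharFun P (σ 0) T θ)
    ((norm_truncatedCharFun_le (hm 0) θ).trans_lt (by linarith))).mul_right
    (Complex.exp (θ * T * Complex.I) * P.real {ω | T < σ 0 ω})
  rw [charFun_apply_real, integral_map hE hcont.aestronglyMeasurable, hsum.unique hgeo]
  ring

/-- A geometric sum is almost everywhere measurable. -/
lemma aemeasurable_of_eq_on_firstExceedance (hm : ∀ n, Measurable (σ n)) (hi : iIndepFun σ P)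
    (hid : ∀ n, P.map (σ n) = P.map (σ 0)) (hp : 0 < P {ω | T < σ 0 ω})
    {E : Ω → ℝ}
    (hEeq : ∀ᵐ ω ∂P, ∀ n, ω ∈ firstExceedance σ T n → E ω = resetTime σ n ω + T) :
    AEMeasurable E P := by
  have hτ : ∀ n, Measurable (resetTime σ n) := fun n => by
    unfold resetTime
    exact Finset.measurable_fun_sum _ fun i _ => hm i
  refine ⟨fun ω => ∑' n, (firstExceedance σ T n).indicator (fun ω => resetTime σ n ω + T) ω,
    Measurable.tsum fun n => ((hτ n).add_const T).indicator (measurableSet_firstExceedance hm n), ?_⟩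
  filter_upwards [ae_exists_lt hm hi hid hp, hEeq] with ω hω h
  obtain ⟨n, hn⟩ := exists_mem_firstExceedance hω
  rw [tsum_eq_single n fun m hmn => Set.indicator_of_notMem
    (fun h' => Set.disjoint_left.1 (pairwise_disjoint_firstExceedance σ T hmn) h' hn) _,
    Set.indicator_of_mem hn, h n hn]

end Geometric

end SpikeReset

namespace SpikeReset

/-! ### Expansion of the truncated characteristic function -/

section Truncation

variable {Ω : Type*} [MeasurableSpace Ω] {P : Measure Ω} [IsProbabilityMeasure P]
  {s : Ω → ℝ} {T : ℝ}

/-- The mean of `s` truncated to the event `s ≤ T`. -/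
noncomputable def truncatedMean (P : Measure Ω) (s : Ω → ℝ) (T : ℝ) : ℝ :=
  ∫ ω, (if s ω ≤ T then s ω else 0) ∂P

lemma integrable_truncation (hs : Measurable s) (hpos : ∀ᵐ ω ∂P, 0 < s ω) :
    Integrable (fun ω => if s ω ≤ T then s ω else 0) P := by
  refine Integrable.of_bound
    (Measurable.ite (measurableSet_le hs measurable_const) hs measurable_const).aestronglyMeasurable
    |T| ?_
  filter_upwards [hpos] with ω hω
  split_ifs with h
  · rw [Real.norm_of_nonneg hω.le]; exact h.trans (le_abs_self T)
  · simp

/-- Taylor expansion of the exponential. The remainder is kept as `T` times the truncated mean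
rather than `T ^ 2`, so that it remains negligible after division by `P(s > T)`. -/
lemma norm_one_sub_truncatedCharFun_sub_le (hs : Measurable s) (hpos : ∀ᵐ ω ∂P, 0 < s ω)
    {θ : ℝ} (hθ : |θ| * T ≤ 1) :
    ‖1 - truncatedCharFun P s T θ -
      (P.real {ω | T < s ω} - θ * Complex.I * truncatedMean P s T)‖ ≤
      θ ^ 2 * T * truncatedMean P s T := by
  have hms : MeasurableSet {ω | T < s ω} := measurableSet_lt measurable_const hs
  have hint := integrable_truncation (T := T) hs hpos
  have hphi : Integrable
      (fun ω => if s ω ≤ T then Complex.exp (θ * s ω * Complex.I) else 0) P := by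
    refine Integrable.of_bound (Measurable.ite (measurableSet_le hs measurable_const)
      (by fun_prop) measurable_const).aestronglyMeasurable 1 (ae_of_all _ fun ω => ?_)
    split_ifs
    · have := Complex.norm_exp_ofReal_mul_I (θ * s ω)
      push_cast at this
      exact this.le
    · simp
  have hind : Integrable ({ω | T < s ω}.indicator (fun _ => (1 : ℂ))) P :=
    (integrable_const _).indicator hms
  have hone : 1 - truncatedCharFun P s T θ = ∫ ω, (1 - if s ω ≤ T then
      Complex.exp (θ * s ω * Complex.I) else 0) ∂P := by
    rw [integral_sub (integrable_const _) hphi, truncatedCharFun]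
    simp
  have hp : (P.real {ω | T < s ω} : ℂ) = ∫ ω, {ω | T < s ω}.indicator (fun _ => (1 : ℂ)) ω ∂P := by
    rw [integral_indicator_const _ hms]; simp
  have hm : (θ * Complex.I * truncatedMean P s T : ℂ) =
      ∫ ω, (θ * Complex.I * ((if s ω ≤ T then s ω else 0 : ℝ) : ℂ)) ∂P := by
    rw [integral_const_mul, integral_complex_ofReal, truncatedMean]
  have hmi : Integrable (fun ω => (θ * Complex.I * ((if s ω ≤ T then s ω else 0 : ℝ) : ℂ))) P :=
    hint.ofReal.const_mul _
  have hi1 : Integrable (fun ω => 1 - if s ω ≤ T then Complex.exp (θ * s ω * Complex.I) else 0) P :=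
    (integrable_const _).sub hphi
  have hi2 : Integrable (fun ω => {ω | T < s ω}.indicator (fun _ => (1 : ℂ)) ω -
      θ * Complex.I * ((if s ω ≤ T then s ω else 0 : ℝ) : ℂ)) P := hind.sub hmi
  rw [hp, hm, hone, ← integral_sub hind hmi, ← integral_sub hi1 hi2,
    truncatedMean, ← integral_const_mul]
  refine norm_integral_le_of_norm_le (hint.const_mul _) ?_
  filter_upwards [hpos] with ω hω
  by_cases h : s ω ≤ T
  · rw [if_pos h, if_pos h, Set.indicator_of_notMem (by simpa using h)]
    have hn : ‖(θ * s ω * Complex.I : ℂ)‖ = |θ| * s ω := by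
      simp [abs_of_pos hω]
    have hb := Complex.norm_exp_sub_one_sub_id_le (x := θ * s ω * Complex.I)
      (by rw [hn]; exact (mul_le_mul_of_nonneg_left h (abs_nonneg θ)).trans hθ)
    rw [hn] at hb
    calc _ = ‖Complex.exp (θ * s ω * Complex.I) - 1 - θ * s ω * Complex.I‖ := by
          rw [← norm_neg]; congr 1; ring
      _ ≤ (|θ| * s ω) ^ 2 := hb
      _ = θ ^ 2 * (s ω * s ω) := by rw [mul_pow, sq_abs]; ring
      _ ≤ θ ^ 2 * (T * s ω) := by gcongr
      _ = _ := by ring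
  · rw [if_neg h, if_neg h, Set.indicator_of_mem (by simpa using h)]
    simp

/-- Layer cake formula for the truncated mean. -/
lemma truncatedMean_eq (hs : Measurable s) (hpos : ∀ᵐ ω ∂P, 0 < s ω) (hT : 0 ≤ T) {S : ℝ → ℝ}
    (hS : ∀ t, 0 < t → P.real {ω | t < s ω} = S t) :
    truncatedMean P s T = (∫ t in (0 : ℝ)..T, S t) - T * P.real {ω | T < s ω} := by
  have hms : MeasurableSet {ω | T < s ω} := measurableSet_lt measurable_const hs
  have hint := integrable_truncation (T := T) hs hpos
  have hind : Integrable ({ω | T < s ω}.indicator (fun _ => T)) P :=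
    (integrable_const _).indicator hms
  -- The tail integral over `[0, T]` is the mean of `min s T`, which exceeds the truncated mean by
  -- `T * P(s > T)`.
  have hsplit : (fun ω => min (s ω) T) = fun ω =>
      (if s ω ≤ T then s ω else 0) + {ω | T < s ω}.indicator (fun _ => T) ω := by
    ext ω
    by_cases h : s ω ≤ T
    · rw [if_pos h, Set.indicator_of_notMem (by simpa using h), min_eq_left h, add_zero]
    · rw [if_neg h, Set.indicator_of_mem (by simpa using h), min_eq_right (not_le.1 h).le, zero_add]
  have hmin : ∫ ω, min (s ω) T ∂P = ∫ t in (0 : ℝ)..T, S t := by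
    rw [Integrable.integral_eq_integral_meas_lt (by rw [hsplit]; exact hint.add hind)
      (by filter_upwards [hpos] with ω hω; exact le_min hω.le hT),
      intervalIntegral.integral_of_le hT, integral_Ioc_eq_integral_Ioo,
      ← integral_indicator measurableSet_Ioi, ← integral_indicator measurableSet_Ioo]
    congr 1
    ext t
    by_cases h0 : 0 < t
    · rw [Set.indicator_of_mem (show t ∈ Set.Ioi (0 : ℝ) from h0)]
      by_cases h1 : t < T
      · rw [Set.indicator_of_mem (show t ∈ Set.Ioo 0 T from ⟨h0, h1⟩), ← hS t h0]
        congr 1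
        ext ω; simp [h1]
      · rw [Set.indicator_of_notMem (fun h => h1 h.2)]
        simp [h1]
    · rw [Set.indicator_of_notMem (show t ∉ Set.Ioi 0 from h0),
        Set.indicator_of_notMem (fun h => h0 h.1)]
  rw [← hmin, hsplit, integral_add hint hind, integral_indicator_const _ hms, truncatedMean]
  simp [mul_comm]

end Truncation

/-! ### The deterministic flow and its survival function -/

section Flow

variable {f h : ℝ → ℝ} {ε : ℝ} {x : ℝ → ℝ}

lemma IsFlow.continuousOn (hx : IsFlow f h ε x) : ContinuousOn x (Set.Ici 0) :=
  fun t ht => (hx.ode t ht).continuousWithinAt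

lemma IsFlow.hasDerivAt (hx : IsFlow f h ε x) {t : ℝ} (ht : 0 < t) :
    HasDerivAt x (ε⁻¹ * drift f h ε (x t)) t :=
  (hx.ode t ht.le).hasDerivAt (Ici_mem_nhds ht)

/-- Freezing the flow at negative times by `max t 0` gives a function continuous on all of `ℝ`,
whose integral has two-sided derivatives. -/
lemma IsFlow.continuous_comp (hx : IsFlow f h ε x) {g : ℝ → ℝ}
    (hg : ContinuousOn g (Set.Icc 0 1)) : Continuous fun t => g (x (max t 0)) :=
  hg.comp_continuous
    (hx.continuousOn.comp_continuous (by fun_prop) fun t => le_max_right t 0)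
    fun t => hx.mem_Icc _ (le_max_right t 0)

lemma survival_pos (h : ℝ → ℝ) (ε : ℝ) (x : ℝ → ℝ) (t : ℝ) : 0 < survival h ε x t := Real.exp_pos _

lemma IsFlow.survival_eq (x : ℝ → ℝ) {t : ℝ} (ht : 0 ≤ t) :
    survival h ε x t = Real.exp (-(ε⁻¹ * ∫ s in (0 : ℝ)..t, h (x (max s 0)))) := by
  unfold survival
  congr 3
  refine intervalIntegral.integral_congr fun s hs => ?_
  rw [Set.uIcc_of_le ht] at hs
  simp [max_eq_left hs.1]

lemma IsFlow.hasDerivAt_survival (hx : IsFlow f h ε x) (hh : ContinuousOn h (Set.Icc 0 1)) (t : ℝ) :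
    HasDerivAt (fun t => Real.exp (-(ε⁻¹ * ∫ s in (0 : ℝ)..t, h (x (max s 0)))))
      (Real.exp (-(ε⁻¹ * ∫ s in (0 : ℝ)..t, h (x (max s 0)))) * -(ε⁻¹ * h (x (max t 0)))) t :=
  (((hx.continuous_comp hh).integral_hasStrictDerivAt 0 t).hasDerivAt.const_mul ε⁻¹).neg.exp

lemma IsFlow.continuousOn_survival (hx : IsFlow f h ε x) (hh : ContinuousOn h (Set.Icc 0 1)) :
    ContinuousOn (survival h ε x) (Set.Ici 0) := by
  have hc : Continuous fun t => Real.exp (-(ε⁻¹ * ∫ s in (0 : ℝ)..t, h (x (max s 0)))) :=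
    continuous_iff_continuousAt.2 fun t => (hx.hasDerivAt_survival hh t).continuousAt
  exact hc.continuousOn.congr fun t ht => IsFlow.survival_eq x ht

lemma IsFlow.continuousOn_comp (hx : IsFlow f h ε x) {g : ℝ → ℝ}
    (hg : ContinuousOn g (Set.Icc 0 1)) : ContinuousOn (fun t => g (x t)) (Set.Ici 0) :=
  hg.comp hx.continuousOn hx.mem_Icc

lemma intervalIntegrable_of_continuousOn_Ici {g : ℝ → ℝ} (hg : ContinuousOn g (Set.Ici 0))
    {a b : ℝ} (ha : 0 ≤ a) (hab : a ≤ b) : IntervalIntegrable g volume a b :=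
  (hg.mono fun s hs => by
    rw [Set.uIcc_of_le hab] at hs; exact ha.trans hs.1).intervalIntegrable

/-- The derivative of `x_t μ_t` is `μ_t f(x_t)`. -/
lemma IsFlow.mul_survival_eq (hx : IsFlow f h ε x) (hε : 0 < ε)
    (hf : ContinuousOn f (Set.Icc 0 1)) (hh : ContinuousOn h (Set.Icc 0 1)) {T : ℝ} (hT : 0 ≤ T) :
    x T * survival h ε x T = ∫ s in (0 : ℝ)..T, survival h ε x s * f (x s) := by
  have hS := hx.continuousOn_survival hh
  have hsub : Set.Icc 0 T ⊆ Set.Ici 0 := fun s hs => hs.1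
  have key := intervalIntegral.integral_eq_sub_of_hasDerivAt_of_le (a := 0) (b := T)
    (f := fun s => x s * survival h ε x s) (f' := fun s => survival h ε x s * f (x s)) hT
    ((hx.continuousOn.mul hS).mono hsub)
    (fun t ht => by
      -- The part `ε⁻¹ x h(x)` of the speed cancels the contribution of `μ' = -ε⁻¹ h(x) μ`.
      have hd := (hx.hasDerivAt ht.1).mul (hx.hasDerivAt_survival hh t)
      rw [max_eq_left ht.1.le, ← IsFlow.survival_eq x ht.1.le] at hd
      have hd' := hd.congr_of_eventuallyEq (f₁ := fun s => x s * survival h ε x s) (by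
        filter_upwards [lt_mem_nhds ht.1] with s hs
        rw [Pi.mul_apply, IsFlow.survival_eq x hs.le])
      convert! hd' using 1
      unfold drift
      field_simp
      ring)
    (intervalIntegrable_of_continuousOn_Ici (hS.mul (hx.continuousOn_comp hf)) le_rfl hT)
  rw [key, hx.init]
  ring

/-- The measure `μ_t dt` on `[0, T]` concentrates near `x = 0` when `T` is small. -/
lemma IsFlow.abs_mul_survival_sub_le (hx : IsFlow f h ε x) (hε : 0 < ε)
    (hf : ContinuousOn f (Set.Icc 0 1)) (hh : ContinuousOn h (Set.Icc 0 1))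
    {L M : ℝ} (hL0 : 0 ≤ L) (hL : ∀ u ∈ Set.Icc (0 : ℝ) 1, |f u - f 0| ≤ L * u)
    (hM : ∀ u ∈ Set.Icc (0 : ℝ) 1, |f u| ≤ M) {T : ℝ} (hT : 0 ≤ T) :
    |x T * survival h ε x T - f 0 * ∫ s in (0 : ℝ)..T, survival h ε x s| ≤
      L * M * T * ∫ s in (0 : ℝ)..T, survival h ε x s := by
  set A := ∫ s in (0 : ℝ)..T, survival h ε x s with hA
  have hM0 : 0 ≤ M := (abs_nonneg _).trans (hM 0 (by simp))
  have hS := hx.continuousOn_survival hh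
  have hSf : ContinuousOn (fun s => survival h ε x s * f (x s)) (Set.Ici 0) :=
    hS.mul (hx.continuousOn_comp hf)
  -- The identity for `x_s μ_s`, used at every intermediate `s`, bounds `μ x` by `M * A`; by the
  -- Lipschitz bound the error integrand is then at most `L * (M * A)`.
  have hAs : ∀ s ∈ Set.Icc 0 T, survival h ε x s * x s ≤ M * A := fun s hs => by
    rw [mul_comm, hx.mul_survival_eq hε hf hh hs.1]
    calc ∫ r in (0 : ℝ)..s, survival h ε x r * f (x r)
        ≤ ∫ r in (0 : ℝ)..s, M * survival h ε x r := by
          refine intervalIntegral.integral_mono_on hs.1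
            (intervalIntegrable_of_continuousOn_Ici hSf le_rfl hs.1)
            (intervalIntegrable_of_continuousOn_Ici (hS.const_mul M) le_rfl hs.1) fun r hr => ?_
          rw [mul_comm]
          exact mul_le_mul_of_nonneg_right ((le_abs_self _).trans (hM _ (hx.mem_Icc r hr.1)))
            (survival_pos ..).le
      _ = M * ∫ r in (0 : ℝ)..s, survival h ε x r := intervalIntegral.integral_const_mul _ _
      _ ≤ M * A := by
          refine mul_le_mul_of_nonneg_left ?_ hM0
          rw [hA, ← intervalIntegral.integral_add_adjacent_intervals
            (intervalIntegrable_of_continuousOn_Ici hS le_rfl hs.1)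
            (intervalIntegrable_of_continuousOn_Ici hS hs.1 hs.2)]
          exact le_add_of_nonneg_right
            (intervalIntegral.integral_nonneg hs.2 fun _ _ => (survival_pos ..).le)
  rw [hx.mul_survival_eq hε hf hh hT, ← intervalIntegral.integral_const_mul,
    ← intervalIntegral.integral_sub (intervalIntegrable_of_continuousOn_Ici hSf le_rfl hT)
      (intervalIntegrable_of_continuousOn_Ici (hS.const_mul _) le_rfl hT)]
  have hb := intervalIntegral.norm_integral_le_of_norm_le_const (a := 0) (b := T)
    (f := fun s => survival h ε x s * f (x s) - f 0 * survival h ε x s) (C := L * (M * A))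
    fun s hs => by
      rw [Set.uIoc_of_le hT] at hs
      have hs' : s ∈ Set.Icc 0 T := ⟨hs.1.le, hs.2⟩
      calc ‖survival h ε x s * f (x s) - f 0 * survival h ε x s‖
          = survival h ε x s * |f (x s) - f 0| := by
            rw [← abs_of_pos (survival_pos h ε x s), ← abs_mul, abs_of_pos (survival_pos h ε x s),
              Real.norm_eq_abs]
            congr 1; ring
        _ ≤ survival h ε x s * (L * x s) :=
            mul_le_mul_of_nonneg_left (hL _ (hx.mem_Icc s hs'.1)) (survival_pos ..).le
        _ = L * (survival h ε x s * x s) := by ring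
        _ ≤ L * (M * A) := mul_le_mul_of_nonneg_left (hAs s hs') hL0
  rw [Real.norm_eq_abs, sub_zero, abs_of_nonneg hT] at hb
  exact hb.trans_eq (by ring)

/-- If the speed of the flow is at least `v` on `[0, η]` and at least `K` on `[η, y]`, then the flow
stays below the level `y` at most for the time `η / v + 1 / K`. -/
lemma IsFlow.time_le (hx : IsFlow f h ε x) {v K η y t : ℝ} (hv : 0 < v) (hK : 0 < K) (hη : 0 ≤ η)
    (h1 : ∀ u ∈ Set.Icc 0 η, v ≤ ε⁻¹ * drift f h ε u)
    (h2 : ∀ u ∈ Set.Icc η y, K ≤ ε⁻¹ * drift f h ε u) (ht : 0 ≤ t)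
    (hy : ∀ s ∈ Set.Icc 0 t, x s ≤ y) : t ≤ η / v + 1 / K := by
  by_contra! hlt
  have hv0 : 0 ≤ η / v := by positivity
  have hK0 : 0 < 1 / K := by positivity
  have hmono : MonotoneOn x (Set.Icc 0 t) := by
    refine monotoneOn_of_deriv_nonneg (convex_Icc 0 t)
      (hx.continuousOn.mono fun s hs => hs.1) ?_ ?_
    · intro s hs
      rw [interior_Icc] at hs
      exact (hx.hasDerivAt hs.1).differentiableAt.differentiableWithinAt
    · intro s hs
      rw [interior_Icc] at hs
      rw [(hx.hasDerivAt hs.1).deriv]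
      have hs' : s ∈ Set.Icc 0 t := Set.Ioo_subset_Icc_self hs
      rcases le_total (x s) η with hle | hle
      · exact hv.le.trans (h1 _ ⟨(hx.mem_Icc s hs.1.le).1, hle⟩)
      · exact hK.le.trans (h2 _ ⟨hle, hy s hs'⟩)
  have hgrow : ∀ a b c : ℝ, 0 ≤ a → a ≤ b → (∀ s ∈ Set.Ioo a b, c ≤ ε⁻¹ * drift f h ε (x s)) →
      c * (b - a) ≤ x b - x a := fun a b c ha hab hc =>
    (convex_Icc a b).mul_sub_le_image_sub_of_le_deriv
      (hx.continuousOn.mono fun s hs => ha.trans hs.1)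
      (fun s hs => by
        rw [interior_Icc] at hs
        exact (hx.hasDerivAt (ha.trans_lt hs.1)).differentiableAt.differentiableWithinAt)
      (fun s hs => by
        rw [interior_Icc] at hs
        rw [(hx.hasDerivAt (ha.trans_lt hs.1)).deriv]
        exact hc s hs) a (Set.left_mem_Icc.2 hab) b (Set.right_mem_Icc.2 hab) hab
  have hmem : η / v ∈ Set.Icc 0 t := ⟨hv0, by linarith⟩
  have hxη : η ≤ x (η / v) := by
    by_contra! hc
    have := hgrow 0 (η / v) v le_rfl hv0 fun s hs => h1 _ ⟨(hx.mem_Icc s hs.1.le).1,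
      (hmono ⟨hs.1.le, hs.2.le.trans hmem.2⟩ hmem hs.2.le).trans hc.le⟩
    rw [hx.init, sub_zero, sub_zero, mul_div_cancel₀ _ hv.ne'] at this
    linarith
  have := hgrow (η / v) t K hv0 hmem.2 fun s hs =>
    h2 _ ⟨hxη.trans (hmono hmem ⟨hv0.trans hs.1.le, hs.2.le⟩ hs.1.le),
      hy s ⟨hv0.trans hs.1.le, hs.2.le⟩⟩
  -- The level `η` is passed by time `η / v`; moving on at speed `K` for longer than `1 / K` would
  -- cover a distance above `1`, the length of the state space.
  have hlt' : 1 < K * (t - η / v) := by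
    have : 1 / K < t - η / v := by linarith
    rwa [div_lt_iff₀ hK, mul_comm] at this
  linarith [(hx.mem_Icc t ht).2, (hx.mem_Icc _ hv0).1]

/-- At the passage time of a level, the flow is at this level. -/
lemma IsFlow.eq_of_isGLB (hx : IsFlow f h ε x) {y T : ℝ} (hy : 0 ≤ y)
    (hT : IsGLB {t : ℝ | 0 ≤ t ∧ y < x t} T) : x T = y := by
  have hT0 : 0 ≤ T := hT.2 fun t ht => ht.1
  apply le_antisymm
  · by_contra! hc
    have hTpos : 0 < T := lt_of_le_of_ne hT0 fun h0 => by
      rw [← h0, hx.init] at hc; linarith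
    have hev : ∀ᶠ s in 𝓝[<] T, y < x s ∧ 0 < s :=
      nhdsWithin_le_nhds (((hx.hasDerivAt hTpos).continuousAt.eventually (lt_mem_nhds hc)).and
        (lt_mem_nhds hTpos))
    obtain ⟨s, ⟨h1, h2⟩, h3⟩ := (hev.and self_mem_nhdsWithin).exists
    exact absurd (hT.1 ⟨h2.le, h1⟩) (not_le.2 h3)
  · by_contra! hc
    have hne : {t : ℝ | 0 ≤ t ∧ y < x t}.Nonempty := hT.nonempty
    have hcl := hT.mem_closure hne
    have hsub : {t : ℝ | 0 ≤ t ∧ y < x t} ⊆ Set.Ici 0 := fun t ht => ht.1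
    have hcont := (hx.continuousOn T hT0).mono hsub
    have := mem_closure_iff_nhdsWithin_neBot.1 hcl
    obtain ⟨s, h1, h2⟩ := ((hcont.eventually (gt_mem_nhds hc)).and self_mem_nhdsWithin).exists
    exact absurd h2.2 (not_lt.2 h1.le)

end Flow

end SpikeReset

namespace SpikeReset

/-! ### Law of the waiting times and measurability of the first jump -/

section WaitingTimes

variable {Ω : Type*} [MeasurableSpace Ω] {P : Measure Ω}
  {f h x : ℝ → ℝ} {ε β T : ℝ} {σ : ℕ → Ω → ℝ}

lemma IsWaitingTimes.measurableSet_lt (hσ : IsWaitingTimes P h ε x σ) (n : ℕ) (t : ℝ) :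
    MeasurableSet {ω | t < σ n ω} :=
  _root_.measurableSet_lt measurable_const (hσ.measurable n)

lemma IsWaitingTimes.measure_lt_of_nonpos [IsProbabilityMeasure P]
    (hσ : IsWaitingTimes P h ε x σ) (n : ℕ) {t : ℝ} (ht : t ≤ 0) : P {ω | t < σ n ω} = 1 := by
  rw [← mem_ae_iff_prob_eq_one (hσ.measurableSet_lt n t)]
  filter_upwards [hσ.pos n] with ω hω using ht.trans_lt hω

/-- The tail formula determines the distribution function at positive times, almost sure positivity
at the others. -/
lemma IsWaitingTimes.map_eq [IsProbabilityMeasure P] (hσ : IsWaitingTimes P h ε x σ) (n : ℕ) :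
    P.map (σ n) = P.map (σ 0) := by
  have := Measure.isProbabilityMeasure_map (hσ.measurable n).aemeasurable (μ := P)
  refine Measure.ext_of_Iic _ _ fun a => ?_
  rw [Measure.map_apply (hσ.measurable n) measurableSet_Iic,
    Measure.map_apply (hσ.measurable 0) measurableSet_Iic]
  have hc : ∀ k, σ k ⁻¹' Set.Iic a = {ω | a < σ k ω}ᶜ := fun k => by ext; simp
  rw [hc, hc, prob_compl_eq_one_sub (hσ.measurableSet_lt n a),
    prob_compl_eq_one_sub (hσ.measurableSet_lt 0 a)]
  rcases lt_or_ge 0 a with ha | ha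
  · rw [hσ.tail n a ha, hσ.tail 0 a ha]
  · rw [hσ.measure_lt_of_nonpos n ha, hσ.measure_lt_of_nonpos 0 ha]

lemma IsWaitingTimes.measureReal_tail (hσ : IsWaitingTimes P h ε x σ) (n : ℕ) {t : ℝ}
    (ht : 0 < t) : P.real {ω | t < σ n ω} = survival h ε x t := by
  rw [measureReal_def, hσ.tail n t ht, ENNReal.toReal_ofReal (survival_pos ..).le]

lemma IsWaitingTimes.measure_lt_pos [IsProbabilityMeasure P] (hσ : IsWaitingTimes P h ε x σ)
    (T : ℝ) : 0 < P {ω | T < σ 0 ω} := by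
  rcases lt_or_ge 0 T with hT | hT
  · rw [hσ.tail 0 T hT]
    exact ENNReal.ofReal_pos.2 (survival_pos ..)
  · rw [hσ.measure_lt_of_nonpos 0 hT]
    exact one_pos

lemma IsWaitingTimes.ae_firstJump_eq (hσ : IsWaitingTimes P h ε x σ)
    (hT : IsGLB {t : ℝ | 0 ≤ t ∧ threshold β ε < x t} T) :
    ∀ᵐ ω ∂P, ∀ n, ω ∈ firstExceedance σ T n →
      firstJump β ε x σ ω = ENNReal.ofReal (resetTime σ n ω + T) := by
  filter_upwards [ae_all_iff.2 hσ.pos] with ω hω n hn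
  exact passageTime_resetProcess_eq hT hω hn.1 hn.2

lemma IsWaitingTimes.ae_toReal_firstJump_eq (hσ : IsWaitingTimes P h ε x σ)
    (hT : IsGLB {t : ℝ | 0 ≤ t ∧ threshold β ε < x t} T) :
    ∀ᵐ ω ∂P, ∀ n, ω ∈ firstExceedance σ T n →
      (firstJump β ε x σ ω).toReal = resetTime σ n ω + T := by
  have hT0 : 0 ≤ T := hT.2 fun t ht => ht.1
  filter_upwards [hσ.ae_firstJump_eq hT, ae_all_iff.2 hσ.pos] with ω h1 hω n hn
  rw [h1 n hn, ENNReal.toReal_ofReal (add_nonneg (resetTime_nonneg hω n) hT0)]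

lemma IsWaitingTimes.ae_firstJump_lt_top [IsProbabilityMeasure P]
    (hσ : IsWaitingTimes P h ε x σ) (hT : IsGLB {t : ℝ | 0 ≤ t ∧ threshold β ε < x t} T) :
    ∀ᵐ ω ∂P, firstJump β ε x σ ω < ⊤ := by
  filter_upwards [ae_exists_lt hσ.measurable hσ.indep hσ.map_eq (hσ.measure_lt_pos T),
    hσ.ae_firstJump_eq hT] with ω hω h1
  obtain ⟨n, hn⟩ := exists_mem_firstExceedance hω
  rw [h1 n hn]
  exact ENNReal.ofReal_lt_top

/-- Convergence in distribution asks for measurability at every `ε`, including those for which the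
flow never passes the threshold; there the jump time is `⊤` and its `toReal` is the constant `0`. -/
lemma IsWaitingTimes.aemeasurable_toReal_firstJump [IsProbabilityMeasure P]
    (hσ : IsWaitingTimes P h ε x σ) (hx0 : x 0 = 0) :
    AEMeasurable (fun ω => (firstJump β ε x σ ω).toReal) P := by
  rcases Set.eq_empty_or_nonempty {t : ℝ | 0 ≤ t ∧ threshold β ε < x t} with he | hne
  · have : ∀ ω, firstJump β ε x σ ω = ⊤ := fun ω =>
      passageTime_resetProcess_eq_top hx0 fun t ht => by
        by_contra! hc
        exact Set.eq_empty_iff_forall_notMem.1 he t ⟨ht, hc⟩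
    simp only [this]
    exact aemeasurable_const
  · have hT := isGLB_csInf hne ⟨0, fun t ht => ht.1⟩
    exact aemeasurable_of_eq_on_firstExceedance hσ.measurable hσ.indep hσ.map_eq
      (hσ.measure_lt_pos _) (hσ.ae_toReal_firstJump_eq hT)

end WaitingTimes

/-! ### Limits as `ε → 0` -/

section Asymptotics

lemma charFun_expMeasure {r : ℝ} (hr : 0 < r) (θ : ℝ) :
    charFun (expMeasure r) θ = r / (r - θ * Complex.I) := by
  have hre : (-(r : ℂ) + θ * Complex.I).re < 0 := by simpa using hr
  have hne : (r : ℂ) - θ * Complex.I ≠ 0 := fun h0 => by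
    have := congrArg Complex.re h0
    simp at this
    exact hr.ne' this
  have hpdf : Measurable (gammaPDF 1 r) := by
    unfold gammaPDF
    exact (measurable_gammaPDFReal 1 r).ennreal_ofReal
  rw [charFun_apply_real, expMeasure, gammaMeasure,
    integral_withDensity_eq_integral_toReal_smul hpdf
      (ae_of_all _ fun _ => ENNReal.ofReal_lt_top)]
  have hfun : (fun t : ℝ => (gammaPDF 1 r t).toReal • Complex.exp (θ * t * Complex.I)) =
      (Set.Ici (0 : ℝ)).indicator
        (fun t : ℝ => r * Complex.exp ((-(r : ℂ) + θ * Complex.I) * t)) := by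
    ext t
    change (exponentialPDF r t).toReal • _ = _
    by_cases ht : 0 ≤ t
    · rw [exponentialPDF_of_nonneg ht, Set.indicator_of_mem (show t ∈ Set.Ici 0 from ht),
        ENNReal.toReal_ofReal (by positivity), Complex.real_smul]
      push_cast
      rw [mul_assoc, ← Complex.exp_add]
      congr 2
      ring
    · rw [exponentialPDF_of_neg (not_le.1 ht), Set.indicator_of_notMem (show t ∉ Set.Ici 0 from ht)]
      simp
  rw [hfun, integral_indicator measurableSet_Ici, integral_Ici_eq_integral_Ioi,
    integral_const_mul, integral_exp_mul_complex_Ioi hre]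
  have hne' : -(r : ℂ) + θ * Complex.I ≠ 0 := fun h0 => hne (by linear_combination -h0)
  field_simp
  simp
  ring

/-- A function vanishing at `1` with nonzero derivative there and positive on `[0, 1)` is bounded
below by a multiple of the distance to `1`. -/
lemma exists_mul_one_sub_le {h : ℝ → ℝ} (hh : DifferentiableOn ℝ h (Set.Icc 0 1)) (hh1 : h 1 = 0)
    (hh1' : derivWithin h (Set.Icc 0 1) 1 ≠ 0) (hhpos : ∀ y ∈ Set.Ico (0 : ℝ) 1, 0 < h y) :
    ∃ c > 0, ∀ u ∈ Set.Icc (0 : ℝ) 1, c * (1 - u) ≤ h u := by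
  set d := derivWithin h (Set.Icc 0 1) 1 with hd
  have hone : (1 : ℝ) ∈ Set.Icc (0 : ℝ) 1 := by simp
  have hslope := hasDerivWithinAt_iff_tendsto_slope.1 (hh 1 hone).hasDerivWithinAt
  have hsl : ∀ u, slope h 1 u = -(h u / (1 - u)) := fun u => by
    rw [slope_def_field, hh1, sub_zero, ← div_neg, neg_sub]
  have hneg : ∀ u ∈ Set.Icc (0 : ℝ) 1, u ≠ 1 → slope h 1 u < 0 := fun u hu hne => by
    have hlt : u < 1 := lt_of_le_of_ne hu.2 hne
    rw [hsl, neg_lt_zero]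
    exact div_pos (hhpos u ⟨hu.1, hlt⟩) (by linarith)
  have hnb : (𝓝[Set.Icc (0 : ℝ) 1 \ {1}] 1).NeBot := by
    rw [Set.Icc_sdiff_right]
    exact right_nhdsWithin_Ico_neBot one_pos
  have hd0 : d < 0 := lt_of_le_of_ne (le_of_tendsto hslope (by
    filter_upwards [self_mem_nhdsWithin] with u hu using (hneg u hu.1 hu.2).le)) hh1'
  -- Filled in with the derivative at `1`, the slope is continuous and negative on the compact
  -- interval; its maximum is `-c`.
  have hcont : ContinuousOn (Function.update (slope h 1) 1 d) (Set.Icc 0 1) := by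
    intro u hu
    rcases eq_or_ne u 1 with rfl | hne
    · exact continuousWithinAt_update_same.2 hslope
    · rw [continuousWithinAt_update_of_ne hne]
      have h1 : ContinuousWithinAt (fun u => -(h u / (1 - u))) (Set.Icc 0 1) u :=
        ((hh.continuousOn u hu).div (by fun_prop) (sub_ne_zero.2 hne.symm)).neg
      exact h1.congr (fun v _ => hsl v) (hsl u)
  obtain ⟨v, hv, hmax⟩ := isCompact_Icc.exists_isMaxOn ⟨1, hone⟩ hcont
  refine ⟨-Function.update (slope h 1) 1 d v, ?_, fun u hu => ?_⟩
  · rw [gt_iff_lt, neg_pos]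
    rcases eq_or_ne v 1 with rfl | hne
    · rwa [Function.update_self]
    · rw [Function.update_of_ne hne]
      exact hneg v hv hne
  · rcases eq_or_ne u 1 with rfl | hne
    · rw [sub_self, mul_zero, hh1]
    · have := hmax hu
      simp only [Set.mem_ofPred_eq, Function.update_of_ne hne, hsl] at this
      have hlt : 0 < 1 - u := sub_pos.2 (lt_of_le_of_ne hu.2 hne)
      rw [← le_div_iff₀ hlt]
      linarith

/-- The passage time of the flow at the threshold tends to `0` as `ε → 0`. -/
lemma eventually_exists_isGLB {f h : ℝ → ℝ} {β L M c : ℝ} (hf0 : 0 < f 0)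
    (hβ : β < 1) (hc : 0 < c) (hL0 : 0 ≤ L)
    (hL : ∀ u ∈ Set.Icc (0 : ℝ) 1, |f u - f 0| ≤ L * u)
    (hM : ∀ u ∈ Set.Icc (0 : ℝ) 1, |f u| ≤ M)
    (hh : ∀ u ∈ Set.Icc (0 : ℝ) 1, c * (1 - u) ≤ h u) {δ : ℝ} (hδ : 0 < δ) :
    ∀ᶠ ε in 𝓝[>] (0 : ℝ), ∀ x : ℝ → ℝ, IsFlow f h ε x →
      ∃ T, IsGLB {t : ℝ | 0 ≤ t ∧ threshold β ε < x t} T ∧ T < δ := by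
  -- On `[0, η]` the speed is at least `f 0 / 2`, so crossing it takes at most `δ / 4`.
  obtain ⟨η, hη0, hη1, hηL, hηδ⟩ : ∃ η : ℝ, 0 < η ∧ η ≤ 1 ∧ L * η ≤ f 0 / 2 ∧
      η / (f 0 / 2) ≤ δ / 4 := by
    refine ⟨min 1 (min (f 0 / (2 * (L + 1))) (δ * f 0 / 8)), by positivity, min_le_left _ _, ?_, ?_⟩
    · have h1 : min 1 (min (f 0 / (2 * (L + 1))) (δ * f 0 / 8)) ≤ f 0 / (2 * (L + 1)) :=
        (min_le_right _ _).trans (min_le_left _ _)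
      calc _ ≤ (L + 1) * (f 0 / (2 * (L + 1))) := mul_le_mul (by linarith) h1 (by positivity) (by linarith)
        _ = f 0 / 2 := by field_simp
    · rw [div_le_iff₀ (by positivity)]
      exact ((min_le_right _ _).trans (min_le_right _ _)).trans_eq (by ring)
  -- Between `η` and the threshold, `x h(x) ≥ η c ε ^ β`, so the speed is at least `η c ε ^ (β - 1)
  -- - M`. Once this is at least `4 / δ`, the second stretch also takes at most `δ / 4`, and the
  -- total is below `3 δ / 4`.
  have hK : Tendsto (fun ε : ℝ => η * c * ε ^ (β - 1)) (𝓝[>] 0) atTop :=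
    (tendsto_rpow_neg_nhdsGT_zero (by linarith)).const_mul_atTop (by positivity)
  filter_upwards [hK.eventually_ge_atTop (4 / δ + M), self_mem_nhdsWithin] with ε hεK hε x hx
  have hε : 0 < ε := hε
  have hdrift : ∀ u, ε⁻¹ * drift f h ε u = f u + ε⁻¹ * (u * h u) := fun u => by
    unfold drift; field_simp
  have hne : ∃ s ∈ Set.Icc 0 (3 * δ / 4), threshold β ε < x s := by
    by_contra! hcon
    have hle := hx.time_le (v := f 0 / 2) (K := 4 / δ) (η := η) (y := threshold β ε)
      (t := 3 * δ / 4) (by positivity) (by positivity) hη0.le ?_ ?_ (by positivity) hcon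
    · rw [one_div_div] at hle
      linarith
    · intro u hu
      have hu1 : u ∈ Set.Icc (0 : ℝ) 1 := ⟨hu.1, hu.2.trans hη1⟩
      have h1 := (abs_le.1 (hL u hu1)).1
      have h2 : L * u ≤ L * η := mul_le_mul_of_nonneg_left hu.2 hL0
      have h3 : 0 ≤ ε⁻¹ * (u * h u) := by
        have := hh u hu1
        have h4 : 0 ≤ c * (1 - u) := mul_nonneg hc.le (by linarith [hu1.2])
        have h5 := hu.1
        have h6 : 0 ≤ h u := h4.trans this
        positivity
      rw [hdrift]
      linarith
    · intro u hu
      have hpow : 0 < ε ^ β := Real.rpow_pos_of_pos hε β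
      have huT : u ≤ 1 - ε ^ β := hu.2
      have hu1 : u ∈ Set.Icc (0 : ℝ) 1 := ⟨hη0.le.trans hu.1, by linarith⟩
      have h1 := (abs_le.1 (hM u hu1)).1
      have h2 : η * (c * ε ^ β) ≤ u * h u := by
        refine mul_le_mul hu.1 (le_trans ?_ (hh u hu1)) (by positivity) hu1.1
        exact mul_le_mul_of_nonneg_left (by linarith) hc.le
      have h3 : η * c * ε ^ (β - 1) ≤ ε⁻¹ * (u * h u) := by
        rw [Real.rpow_sub hε, Real.rpow_one]
        calc η * c * (ε ^ β / ε) = ε⁻¹ * (η * (c * ε ^ β)) := by field_simp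
          _ ≤ _ := mul_le_mul_of_nonneg_left h2 (by positivity)
      rw [hdrift]
      linarith
  obtain ⟨s, hs, hsy⟩ := hne
  have hbdd : BddBelow {t : ℝ | 0 ≤ t ∧ threshold β ε < x t} := ⟨0, fun t ht => ht.1⟩
  refine ⟨_, isGLB_csInf ⟨s, hs.1, hsy⟩ hbdd, ?_⟩
  exact (csInf_le hbdd ⟨hs.1, hsy⟩).trans_lt (by linarith [hs.2])

/-- Limit of the characteristic functions of geometric sums whose number of terms has a small
success probability `p` and whose terms have truncated mean close to `p / r`. -/
lemma tendsto_geometric_charFun {ι : Type*} {l : Filter ι} {p T A y : ι → ℝ} {φ : ι → ℂ}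
    {r C θ : ℝ} (hr : 0 < r) (hT : Tendsto T l (𝓝 0)) (hy : Tendsto y l (𝓝 1))
    (hp : ∀ᶠ i in l, 0 < p i) (hA : ∀ᶠ i in l, 0 ≤ A i)
    (hyp : ∀ᶠ i in l, |y i * p i - r * A i| ≤ C * T i * A i)
    (hφ : ∀ᶠ i in l, ‖1 - φ i - (p i - θ * Complex.I * (A i - T i * p i : ℝ))‖ ≤
      θ ^ 2 * T i * (A i - T i * p i)) :
    Tendsto (fun i => Complex.exp (θ * T i * Complex.I) * (p i / (1 - φ i))) l
      (𝓝 (r / (r - θ * Complex.I))) := by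
  have hCT : Tendsto (fun i => C * T i) l (𝓝 0) := by simpa using hT.const_mul C
  -- A priori bound on `a = A / p`: once `C T < r / 2` and `y < 2`, the inequality `r a ≤ y + C T a`
  -- gives `a ≤ 4 / r`. The error `C T a` therefore tends to `0`.
  have hbound : ∀ᶠ i in l, A i / p i ≤ 4 / r ∧ |y i - r * (A i / p i)| ≤ C * T i * (A i / p i) := by
    filter_upwards [hp, hA, hyp, hCT.eventually (gt_mem_nhds (half_pos hr)),
      hy.eventually (gt_mem_nhds one_lt_two)] with i hpi hAi hi hC hyi
    have ha : 0 ≤ A i / p i := by positivity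
    have h1 : |y i - r * (A i / p i)| ≤ C * T i * (A i / p i) := by
      have e : y i - r * (A i / p i) = (y i * p i - r * A i) / p i := by field_simp
      rw [e, abs_div, abs_of_pos hpi, ← mul_div_assoc]
      gcongr
    refine ⟨?_, h1⟩
    have h2 := (abs_le.1 h1).1
    have h3 : C * T i * (A i / p i) ≤ r / 2 * (A i / p i) := by gcongr
    rw [le_div_iff₀ hr]
    linarith
  have hdiff : Tendsto (fun i => y i - r * (A i / p i)) l (𝓝 0) := by
    refine squeeze_zero_norm' (a := fun i => |C * T i| * (4 / r)) ?_ (by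
      simpa using hCT.abs.mul_const (4 / r))
    filter_upwards [hbound, hp, hA] with i ⟨h1, h2⟩ hpi hAi
    refine h2.trans ?_
    have ha : 0 ≤ A i / p i := by positivity
    exact mul_le_mul (le_abs_self _) h1 ha (abs_nonneg _)
  have hratio : Tendsto (fun i => A i / p i) l (𝓝 (1 / r)) := by
    have := (hy.sub hdiff).div_const r
    rw [sub_zero] at this
    refine this.congr fun i => ?_
    field_simp
    ring
  have hmean : Tendsto (fun i => A i / p i - T i) l (𝓝 (1 / r)) := by
    simpa using hratio.sub hT
  have hmain : Tendsto (fun i => (1 : ℂ) - θ * Complex.I * ((A i / p i - T i : ℝ) : ℂ)) l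
      (𝓝 (1 - θ * Complex.I * ((1 / r : ℝ) : ℂ))) :=
    (((Complex.continuous_ofReal.tendsto _).comp hmean).const_mul _).const_sub 1
  have herr : Tendsto (fun i => (1 - φ i) / p i -
      ((1 : ℂ) - θ * Complex.I * ((A i / p i - T i : ℝ) : ℂ))) l (𝓝 0) := by
    refine squeeze_zero_norm' (a := fun i => θ ^ 2 * T i * (A i / p i - T i)) ?_ (by
      simpa using (hT.const_mul (θ ^ 2)).mul hmean)
    filter_upwards [hφ, hp] with i hi hpi
    have hpc : (p i : ℂ) ≠ 0 := by exact_mod_cast hpi.ne'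
    have e : (1 - φ i) / p i - ((1 : ℂ) - θ * Complex.I * ((A i / p i - T i : ℝ) : ℂ)) =
        (1 - φ i - (p i - θ * Complex.I * (A i - T i * p i : ℝ))) / p i := by
      push_cast
      field_simp
    rw [e, norm_div, Complex.norm_real, Real.norm_of_nonneg hpi.le, div_le_iff₀ hpi]
    refine hi.trans_eq ?_
    field_simp
  have hlim : Tendsto (fun i => (1 - φ i) / p i) l (𝓝 (1 - θ * Complex.I * ((1 / r : ℝ) : ℂ))) := by
    simpa using herr.add hmain
  have hrc : (r : ℂ) ≠ 0 := by exact_mod_cast hr.ne'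
  have hrθ : (r : ℂ) - θ * Complex.I ≠ 0 := fun h0 => by
    have := congrArg Complex.re h0
    simp at this
    exact hr.ne' this
  have hval : 1 - θ * Complex.I * ((1 / r : ℝ) : ℂ) = (r - θ * Complex.I) / r := by
    push_cast
    field_simp
  rw [hval] at hlim
  have hinv := hlim.inv₀ (div_ne_zero hrθ hrc)
  have hexp : Tendsto (fun i => Complex.exp (θ * T i * Complex.I)) l (𝓝 1) := by
    have hc : Continuous fun t : ℝ => Complex.exp (θ * t * Complex.I) := by fun_prop
    simpa [Function.comp_def] using (hc.tendsto 0).comp hT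
  simpa using hexp.mul hinv

end Asymptotics

end SpikeReset

/-! ### The limit theorem -/

theorem corollary2p3 (f h : ℝ → ℝ)
    (hf : ContDiffOn ℝ 2 f (Set.Icc 0 1)) (hh : ContDiffOn ℝ 2 h (Set.Icc 0 1))
    (hf1 : f 1 < 0) (hf0 : 0 < f 0)
    (hh1 : h 1 = 0) (hh1' : derivWithin h (Set.Icc 0 1) 1 ≠ 0)
    (hhpos : ∀ y ∈ Set.Ico (0 : ℝ) 1, 0 < h y)
    (β : ℝ) (hβ : β ∈ Set.Ioo (0 : ℝ) (1 / 2))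
    -- for each `ε > 0`: the flow, a probability space and the waiting times on it
    (x : Set.Ioi (0 : ℝ) → ℝ → ℝ) (hx : ∀ ε : Set.Ioi (0 : ℝ), SpikeReset.IsFlow f h ε (x ε))
    (Ω : Set.Ioi (0 : ℝ) → Type*) [∀ ε, MeasurableSpace (Ω ε)]
    (P : ∀ ε, Measure (Ω ε)) [∀ ε, IsProbabilityMeasure (P ε)]
    (σ : ∀ ε, ℕ → Ω ε → ℝ) (hσ : ∀ ε : Set.Ioi (0 : ℝ), SpikeReset.IsWaitingTimes (P ε) h ε (x ε) (σ ε))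
    -- an exponential random variable with parameter `f 0`
    (Ω' : Type*) [MeasurableSpace Ω'] (P' : Measure Ω') [IsProbabilityMeasure P']
    (Z : Ω' → ℝ) (hZ : HasLaw Z (expMeasure (f 0)) P') :
    (∀ᶠ ε : Set.Ioi (0 : ℝ) in comap Subtype.val (𝓝 0),
      ∀ᵐ ω ∂(P ε), SpikeReset.firstJump β ε (x ε) (σ ε) ω < ⊤) ∧
    TendstoInDistribution
      (fun ε : Set.Ioi (0 : ℝ) => fun ω => (SpikeReset.firstJump β ε (x ε) (σ ε) ω).toReal)
      (comap Subtype.val (𝓝 0)) Z P P' := by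
  have hβ1 : β < 1 := by linarith [hβ.2]
  have hfc := hf.continuousOn
  have hhc := hh.continuousOn
  obtain ⟨c, hc, hhlow⟩ := SpikeReset.exists_mul_one_sub_le (hh.differentiableOn two_ne_zero)
    hh1 hh1' hhpos
  obtain ⟨K, hK⟩ := hf.exists_lipschitzOnWith two_ne_zero (convex_Icc 0 1) isCompact_Icc
  have hL : ∀ u ∈ Set.Icc (0 : ℝ) 1, |f u - f 0| ≤ K * u := fun u hu => by
    have := hK.dist_le_mul u hu 0 (by simp)
    rwa [Real.dist_eq, Real.dist_eq, sub_zero, abs_of_nonneg hu.1] at this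
  obtain ⟨M, hM⟩ := isCompact_Icc.exists_bound_of_continuousOn hfc
  have hval : Tendsto (Subtype.val : Set.Ioi (0 : ℝ) → ℝ) (comap Subtype.val (𝓝 0)) (𝓝[>] 0) :=
    tendsto_nhdsWithin_iff.2 ⟨tendsto_comap, Eventually.of_forall fun ε => ε.2⟩
  set T : Set.Ioi (0 : ℝ) → ℝ := fun ε =>
    sInf {t : ℝ | 0 ≤ t ∧ SpikeReset.threshold β ε < x ε t}
  have hTδ : ∀ δ > 0, ∀ᶠ ε : Set.Ioi (0 : ℝ) in comap Subtype.val (𝓝 0),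
      IsGLB {t : ℝ | 0 ≤ t ∧ SpikeReset.threshold β ε < x ε t} (T ε) ∧ T ε < δ := fun δ hδ => by
    filter_upwards [hval.eventually (SpikeReset.eventually_exists_isGLB hf0 hβ1 hc K.2 hL hM
      hhlow hδ)] with ε hε
    obtain ⟨S, hS, hSδ⟩ := hε _ (hx ε)
    have : T ε = S := hS.csInf_eq hS.nonempty
    rw [this]
    exact ⟨hS, hSδ⟩
  have hGLB := (hTδ 1 one_pos).mono fun ε h => h.1
  have hT0 : Tendsto T (comap Subtype.val (𝓝 0)) (𝓝 0) := by
    refine Metric.tendsto_nhds.2 fun δ hδ => ?_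
    filter_upwards [hTδ δ hδ] with ε hε
    rw [Real.dist_eq, sub_zero, abs_of_nonneg (hε.1.2 fun t ht => ht.1)]
    exact hε.2
  have hthr : Tendsto (fun ε : Set.Ioi (0 : ℝ) => SpikeReset.threshold β ε)
      (comap Subtype.val (𝓝 0)) (𝓝 1) := by
    have h1 : Tendsto (fun ε : ℝ => 1 - ε ^ β) (𝓝 0) (𝓝 1) := by
      have := (Real.continuousAt_rpow_const 0 β (Or.inr hβ.1.le)).tendsto.const_sub 1
      rwa [Real.zero_rpow hβ.1.ne', sub_zero] at this
    exact h1.comp tendsto_comap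
  refine ⟨hGLB.mono fun ε hε => (hσ ε).ae_firstJump_lt_top hε, ?_⟩
  have hmeas := fun ε => (hσ ε).aemeasurable_toReal_firstJump (β := β) (hx ε).init
  -- Lévy's continuity theorem, applied along an arbitrary sequence of parameters tending to `0`.
  refine ⟨hmeas, hZ.aemeasurable, tendsto_of_seq_tendsto fun u hu =>
    ProbabilityMeasure.tendsto_iff_tendsto_charFun.2 fun θ => ?_⟩
  -- The tail formula holds only at positive times, so `T > 0` is needed; it follows from `x 0 = 0 <
  -- y = x T` once the threshold is positive.
  have hpos : ∀ᶠ ε : Set.Ioi (0 : ℝ) in comap Subtype.val (𝓝 0), 0 < T ε ∧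
      x ε (T ε) = SpikeReset.threshold β ε := by
    filter_upwards [hGLB, hthr.eventually (lt_mem_nhds one_pos)] with ε hε hε'
    have hxT := (hx ε).eq_of_isGLB hε'.le hε
    refine ⟨lt_of_le_of_ne (hε.2 fun t ht => ht.1) fun h0 => ?_, hxT⟩
    rw [← h0, (hx ε).init] at hxT
    exact hε'.ne hxT
  have hlim := SpikeReset.tendsto_geometric_charFun (l := comap Subtype.val (𝓝 0))
    (p := fun ε => (P ε).real {ω | T ε < σ ε 0 ω}) (T := T)
    (A := fun ε => ∫ s in (0 : ℝ)..T ε, SpikeReset.survival h ε (x ε) s)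
    (y := fun ε => SpikeReset.threshold β ε)
    (φ := fun ε => SpikeReset.truncatedCharFun (P ε) (σ ε 0) (T ε) θ) (C := K * M) (θ := θ)
    hf0 hT0 hthr ?_ ?_ ?_ ?_
  · have hchar : ∀ᶠ ε : Set.Ioi (0 : ℝ) in comap Subtype.val (𝓝 0),
        Complex.exp (θ * T ε * Complex.I) * ((P ε).real {ω | T ε < σ ε 0 ω} /
          (1 - SpikeReset.truncatedCharFun (P ε) (σ ε 0) (T ε) θ)) =
        charFun ((P ε).map fun ω => (SpikeReset.firstJump β ε (x ε) (σ ε) ω).toReal) θ := by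
      filter_upwards [hGLB] with ε hε
      exact (SpikeReset.charFun_of_eq_on_firstExceedance (hσ ε).measurable (hσ ε).indep
        (hσ ε).map_eq ((hσ ε).measure_lt_pos _) (hmeas ε) ((hσ ε).ae_toReal_firstJump_eq hε) θ).symm
    have := (hlim.congr' hchar).comp hu
    simp only [ProbabilityMeasure.coe_mk, Function.comp_def, hZ.map_eq,
      SpikeReset.charFun_expMeasure hf0] at this ⊢
    exact this
  · filter_upwards [hpos] with ε hε
    rw [(hσ ε).measureReal_tail 0 hε.1]
    exact SpikeReset.survival_pos ..
  · filter_upwards [hpos] with ε hε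
    exact intervalIntegral.integral_nonneg hε.1.le fun _ _ => (SpikeReset.survival_pos ..).le
  · filter_upwards [hpos] with ε hε
    rw [(hσ ε).measureReal_tail 0 hε.1, ← hε.2]
    exact (hx ε).abs_mul_survival_sub_le ε.2 hfc hhc K.2 hL hM hε.1.le
  · have hθ : Tendsto (fun ε => |θ| * T ε) (comap Subtype.val (𝓝 0)) (𝓝 0) := by
      simpa using hT0.const_mul |θ|
    filter_upwards [hpos, hθ.eventually (gt_mem_nhds one_pos)] with ε hε hθε
    have := SpikeReset.norm_one_sub_truncatedCharFun_sub_le ((hσ ε).measurable 0) ((hσ ε).pos 0)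
      hθε.le
    rwa [SpikeReset.truncatedMean_eq ((hσ ε).measurable 0) ((hσ ε).pos 0) hε.1.le
      fun t ht => (hσ ε).measureReal_tail 0 ht] at this
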